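/- All groups are finite; $\pi(G)$ is the set of primes dividing $|G|$. Let $P$ be a set of primes containing $\pi(G)$ (for instance $P=\pi(G)$ or the set of all primes). A partition $\sigma$ of $P$ is a set of pairwise disjoint nonempty blocks with union $P$; for two partitions of $P$, $\sigma^1\cap\sigma^2$ is the partition whose blocks are the nonempty sets $\sigma^1_i\cap\sigma^2_j$ with $\sigma^1_i\in\sigma^1$, $\sigma^2_j\in\sigma^2$. For a set $\pi$ of primes, a $\pi$-group is a group whose order has all its prime divisors in $\pi$. A group $G$ is *$\sigma$-nilpotent* if it has a normal Hall $\sigma_i$-subgroup for every $\sigma_i\in\sigma$, and *$\sigma$-soluble* if each of its chief factors is a $\sigma_i$-group for some $\sigma_i\in\sigma$. A subgroup $H$ is *$\sigma$-subnormal* in $G$ if there is a chain $H=H_0\le H_1\le\dots\le H_n=G$ such that, for each $1\le i\le n$, either $H_{i-1}\trianglelefteq H_i$ or $H_i/(H_{i-1})_{H_i}$ is a $\sigma_j$-group for some $\sigma_j\in\sigma$, where $(H_{i-1})_{H_i}$ is the largest normal subgroup of $H_i$ contained in $H_{i-1}$. A subgroup $A$ of $G$ is a *$\mathfrak G_\pi$-projector*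 of $G$ if $AN/N$ is maximal among the $\pi$-subgroups of $G/N$ for every $N\trianglelefteq G$; and $H$ is *$\sigma$-$p$-permutable* in $G$ if for every $\sigma_i\in\sigma$ there is a $\mathfrak G_{\sigma_i}$-projector $A_i$ of $G$ with $HA_i^x=A_i^xH$ for all $x\in G$. **Theorem 1.** $\sigma$-nilpotency, $\sigma$-solubility, $\sigma$-subnormality and $\sigma$-$p$-permutability are $\sigma$-properties. That is, let $G$ be a finite group, $H$ a subgroup of $G$ and $P\supseteq\pi(G)$ a set of primes, and let $\theta(\sigma)$ be any one of the following statements about a partition $\sigma$ of $P$: $G$ is $\sigma$-nilpotent; $H$ is $\sigma$-nilpotent; $G$ is $\sigma$-soluble; $H$ is $\sigma$-soluble; $H$ is $\sigma$-subnormal in $G$; $H$ is $\sigma$-$p$-permutable in $G$. Then: 1. if $\theta(\sigma^1)$ and $\theta(\sigma^2)$ hold for partitions $\sigma^1,\sigma^2$ of $P$, then $\theta(\sigma^1\cap\sigma^2)$ holds; 2. if $|\sigma|=1$, then $\theta(\sigma)$ holds. -/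

import Mathlib

universe u

namespace SigmaTheory

/-- `π(G)`: the set of primes dividing the order of `G`. -/
def primesOf (G : Type*) [Group G] : Set ℕ :=
  {p | p.Prime ∧ p ∣ Nat.card G}

/-- `G` is a `π`-group: every prime divisor of its order lies in `π`. -/
def IsPiGroup (π : Set ℕ) (G : Type*) [Group G] : Prop :=
  primesOf G ⊆ π

/-- `H` is a Hall `π`-subgroup of `G`: it is a `π`-group and no prime in `π` divides its index. -/
def IsHallSubgroup {G : Type*} [Group G] (π : Set ℕ) (H : Subgroup G) : Prop :=
  IsPiGroup π H ∧ ∀ p : ℕ, p.Prime → p ∣ H.index → p ∉ π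

/-- `G` is `σ`-nilpotent: it has a normal Hall `s`-subgroup for every block `s` of `σ`. -/
def IsSigmaNilpotent (G : Type*) [Group G] {P : Set ℕ} (σ : Partition P) : Prop :=
  ∀ s ∈ σ, ∃ H : Subgroup G, H.Normal ∧ IsHallSubgroup s H

/-- `A / B` is a chief factor of `G`: `B < A` are normal subgroups of `G` with no normal subgroup
of `G` strictly between them, that is, `A / B` is a minimal normal subgroup of `G / B`. -/
structure IsChiefFactor {G : Type*} [Group G] (A B : Subgroup G) : Prop where
  normal_top : A.Normal
  normal_bot : B.Normal
  lt : B < A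
  minimal : ∀ N : Subgroup G, N.Normal → B ≤ N → N ≤ A → N = B ∨ N = A

/-- `G` is `σ`-soluble: every chief factor `A / B` of `G` is an `s`-group for some block `s`
of `σ`. -/
def IsSigmaSoluble (G : Type*) [Group G] {P : Set ℕ} (σ : Partition P) : Prop :=
  ∀ (A B : Subgroup G) [B.Normal], IsChiefFactor A B →
    ∃ s ∈ σ, IsPiGroup s (A ⧸ B.subgroupOf A)

/-- `H` is `σ`-subnormal in `G`: there is a chain `H = C 0 ≤ C 1 ≤ ⋯ ≤ C n = G` in which each
`C i` is normal in `C (i + 1)`, or `C (i + 1)` modulo the core of `C i` in `C (i + 1)` is an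
`s`-group for some block `s` of `σ`. -/
def IsSigmaSubnormal {G : Type*} [Group G] (H : Subgroup G) {P : Set ℕ} (σ : Partition P) :
    Prop :=
  ∃ (n : ℕ) (C : ℕ → Subgroup G), C 0 = H ∧ C n = ⊤ ∧
    ∀ i < n, C i ≤ C (i + 1) ∧
      (((C i).subgroupOf (C (i + 1))).Normal ∨
        ∃ s ∈ σ, IsPiGroup s (C (i + 1) ⧸ ((C i).subgroupOf (C (i + 1))).normalCore))

/-- `A` is a projector of `G` for the class of `π`-groups: for every normal subgroup `N` of `G`
the image `A N / N` is maximal among the `π`-subgroups of `G / N`. -/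
def IsPiProjector {G : Type*} [Group G] (π : Set ℕ) (A : Subgroup G) : Prop :=
  ∀ (N : Subgroup G) [N.Normal],
    Maximal (fun K : Subgroup (G ⧸ N) => IsPiGroup π K) (A.map (QuotientGroup.mk' N))

/-- The conjugate `A ^ x = x⁻¹ A x`. -/
def conjugate {G : Type*} [Group G] (A : Subgroup G) (x : G) : Subgroup G :=
  A.map (MulAut.conj x⁻¹).toMonoidHom

open scoped Pointwise in
/-- `H` is `σ`-`p`-permutable in `G`: for every block `s` of `σ` there is a projector `A` of `G`
for the class of `s`-groups with `H A ^ x = A ^ x H` for every `x` in `G`. -/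
def IsSigmaPPermutable {G : Type*} [Group G] (H : Subgroup G) {P : Set ℕ} (σ : Partition P) :
    Prop :=
  ∀ s ∈ σ, ∃ A : Subgroup G, IsPiProjector s A ∧
    ∀ x : G, (H : Set G) * (conjugate A x : Set G) = (conjugate A x : Set G) * (H : Set G)

/-- A property `θ G H σ` of a subgroup `H` in a group `G`, depending on a partition `σ`, is a
`σ`-property if, for all finite `G`, all subgroups `H` and all partitions of `π(G)` (more
generally of any set `P` of primes containing `π(G)`, such as the set of all primes),
it is inherited by the meet of two partitions, whose blocks are the nonempty intersections of their
blocks, and it holds for the partitions with exactly one block. -/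
def IsSigmaProperty
    (θ : ∀ (G : Type u) [Group G], Subgroup G → ∀ {P : Set ℕ}, Partition P → Prop) : Prop :=
  ∀ (G : Type u) [Group G] [Finite G] (H : Subgroup G) (P : Set ℕ),
    (∀ p ∈ P, p.Prime) → primesOf G ⊆ P →
      (∀ σ₁ σ₂ : Partition P, θ G H σ₁ → θ G H σ₂ → θ G H (σ₁ ⊓ σ₂)) ∧
      (∀ σ : Partition P, (σ : Set (Set ℕ)).encard = 1 → θ G H σ)

end SigmaTheory

namespace SigmaTheory

/-! Nilpotency and solubility are direct: normal Hall subgroups are intersected, and a chief factor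
is nontrivial, so a prime divisor of its order puts it in a common block. For subnormality
(`SubnormalChain.inf`), induct on `|G|`, using the last proper term `M` of the `σ₁`-chain. If `M` is
not normal, there is a normal `N ≤ M` with `G / N` an `s`-group, `s ∈ σ₁`; in `G / N` a `σ₂`-chain
is already a `σ₁ ⊓ σ₂`-chain, and `HN ≤ M` is proper, so induction in `HN` finishes.

Permutability is harder, since projectors for `s₁ ∩ s₂` cannot be read off from those for `s₁` and
`s₂`. The condition is therefore replaced by `HasPiCover`, which mentions no projector and is stable
under intersecting the sets of primes (`HasPiCover.inter`). Permutability gives a cover for each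
block (`IsSigmaPPermutable.hasPiCover`): the projectors for `s` and those for the other blocks yield
overgroups of `H` of coprime index, normalized by large normal subgroups. Conversely, if `R`
normalizes the cover, each `π`-projector of `R` permutes with `H` (`permutes_of_isPiProjector`), and
it is a projector of `G` since `|G : R|` is a `π'`-number. Such projectors exist by
`exists_isPiProjector`. -/

/-- Every prime divisor of `n` lies in `π`. -/
def IsPiNumber (π : Set ℕ) (n : ℕ) : Prop :=
  ∀ p : ℕ, p.Prime → p ∣ n → p ∈ π

lemma isPiGroup_iff {π : Set ℕ} {G : Type*} [Group G] :
    IsPiGroup π G ↔ IsPiNumber π (Nat.card G) :=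
  ⟨fun h _ hp hd => h ⟨hp, hd⟩, fun h _ hp => h _ hp.1 hp.2⟩

namespace IsPiNumber

variable {π ρ : Set ℕ} {m n : ℕ}

lemma of_dvd (h : IsPiNumber π n) (hd : m ∣ n) : IsPiNumber π m :=
  fun p hp hm => h p hp (hm.trans hd)

lemma mono (h : IsPiNumber π n) (hs : π ⊆ ρ) : IsPiNumber ρ n :=
  fun p hp hn => hs (h p hp hn)

lemma mul (hm : IsPiNumber π m) (hn : IsPiNumber π n) : IsPiNumber π (m * n) :=
  fun p hp hd => (hp.dvd_mul.1 hd).elim (hm p hp) (hn p hp)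

lemma coprime (hm : IsPiNumber π m) (hn : IsPiNumber πᶜ n) : m.Coprime n :=
  Nat.coprime_of_dvd fun p hp h1 h2 => hn p hp h2 (hm p hp h1)

lemma eq_one (h : IsPiNumber π n) (h' : IsPiNumber πᶜ n) : n = 1 :=
  (Nat.coprime_self n).1 (h.coprime h')

lemma one : IsPiNumber π 1 := fun _ hp hd => absurd (Nat.dvd_one.1 hd) hp.ne_one

end IsPiNumber

/-! ### Indices of subgroups and `π`-numbers. -/

section Index

variable {G : Type*} [Group G]

lemma relIndex_dvd_relIndex_of_le_normalizer {N K L : Subgroup G}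
    (hK : K ≤ Subgroup.normalizer (N : Set G)) (h : L ≤ K) : N.relIndex L ∣ N.relIndex K := by
  have : (N.subgroupOf K).Normal := Subgroup.normal_subgroupOf_of_le_normalizer hK
  rw [← Subgroup.relIndex_subgroupOf h]
  exact Subgroup.relIndex_dvd_index_of_normal _ _

/-- If the set `X * T` contains `K ≥ X, T` then `|K : T| = |X : X ∩ T|`. -/
lemma relIndex_eq_of_subset_mul [Finite G] {T X K : Subgroup G} (hX : X ≤ K)
    (h : ∀ k ∈ K, ∃ x ∈ X, ∃ t ∈ T, k = x * t) : T.relIndex K = T.relIndex X := by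
  refine (Nat.card_congr (Equiv.ofBijective (Subgroup.quotientSubgroupOfEmbeddingOfLE T hX)
    ⟨(Subgroup.quotientSubgroupOfEmbeddingOfLE T hX).injective, ?_⟩)).symm
  intro q
  induction q using QuotientGroup.induction_on with
  | H k =>
    obtain ⟨x, hx, t, ht, hk⟩ := h k k.2
    refine ⟨QuotientGroup.mk ⟨x, hx⟩, ?_⟩
    rw [Subgroup.quotientSubgroupOfEmbeddingOfLE_apply_mk, QuotientGroup.eq]
    simpa [Subgroup.mem_subgroupOf, hk] using ht

lemma isPiNumber_index_inf {π ρ : Set ℕ} {A B : Subgroup G}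
    (hA : IsPiNumber π A.index) [A.Normal] (hB : IsPiNumber ρ B.index) :
    IsPiNumber (π ∪ ρ) (A ⊓ B).index := by
  have h := Subgroup.relIndex_mul_index (inf_le_right : A ⊓ B ≤ B)
  rw [Subgroup.inf_relIndex_right] at h
  rw [← h]
  exact ((hA.of_dvd (Subgroup.relIndex_dvd_index_of_normal A B)).mono
    Set.subset_union_left).mul (hB.mono Set.subset_union_right)

lemma mem_of_pow_mem_of_coprime {N : Subgroup G} {y : G} {m : ℕ} (hm : y ^ m ∈ N)
    (hc : (orderOf y).Coprime m) : y ∈ N := by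
  obtain ⟨k, hk⟩ := exists_pow_eq_self_of_coprime hc.symm
  exact hk ▸ N.pow_mem hm k

lemma mem_of_isPiNumber_index [Finite G] {π : Set ℕ} {N : Subgroup G} [N.Normal] {y : G}
    (hN : IsPiNumber π N.index) (hy : IsPiNumber πᶜ (orderOf y)) : y ∈ N :=
  mem_of_pow_mem_of_coprime (N.pow_index_mem y) (hN.coprime hy).symm

end Index

lemma card_subgroup_lt_card {G : Type*} [Group G] [Finite G] {M : Subgroup G} (hM : M ≠ ⊤) :
    Nat.card M < Nat.card G :=
  lt_of_le_of_ne (Nat.le_of_dvd Nat.card_pos M.card_subgroup_dvd_card)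
    fun h => hM (Subgroup.eq_top_of_card_eq M h)

lemma eq_of_encard_eq_one {P : Set ℕ} {σ : Partition P} (h : (σ : Set (Set ℕ)).encard = 1) :
    P ∈ σ ∧ ∀ s ∈ σ, s = P := by
  obtain ⟨s, hs⟩ := Set.encard_eq_one.1 h
  have hP : s = P := by
    have := σ.sSup_eq
    rw [hs] at this
    simpa using this
  subst hP
  exact ⟨by rw [← SetLike.mem_coe, hs]; rfl, fun t ht => by
    rw [← SetLike.mem_coe, hs] at ht; exact ht⟩

/-- The prime `p` is needed because empty intersections are not blocks of the meet; below it is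
always a prime divisor of a nontrivial index. -/
lemma inter_mem_inf {P : Set ℕ} {σ₁ σ₂ : Partition P} {s₁ s₂ : Set ℕ} (h₁ : s₁ ∈ σ₁) (h₂ : s₂ ∈ σ₂)
    {p : ℕ} (hp₁ : p ∈ s₁) (hp₂ : p ∈ s₂) : s₁ ∩ s₂ ∈ σ₁ ⊓ σ₂ :=
  Partition.mem_inf_iff.2 ⟨fun h => (h ▸ (⟨hp₁, hp₂⟩ : p ∈ s₁ ∩ s₂) : p ∈ (⊥ : Set ℕ)),
    s₁, h₁, s₂, h₂, rfl⟩

lemma primesOf_subgroup_subset {G : Type*} [Group G] [Finite G] (H : Subgroup G) :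
    primesOf H ⊆ primesOf G :=
  fun _ hp => ⟨hp.1, hp.2.trans H.card_subgroup_dvd_card⟩

/-! ### `σ`-nilpotency and `σ`-solubility -/

lemma isSigmaNilpotent_inf {G : Type*} [Group G] [Finite G] {P : Set ℕ} {σ₁ σ₂ : Partition P}
    (h₁ : IsSigmaNilpotent G σ₁) (h₂ : IsSigmaNilpotent G σ₂) : IsSigmaNilpotent G (σ₁ ⊓ σ₂) := by
  intro s hs
  obtain ⟨-, s₁, hs₁, s₂, hs₂, rfl⟩ := Partition.mem_inf_iff.1 hs
  obtain ⟨H₁, hn₁, hp₁, hi₁⟩ := h₁ s₁ hs₁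
  obtain ⟨H₂, hn₂, hp₂, hi₂⟩ := h₂ s₂ hs₂
  refine ⟨H₁ ⊓ H₂, inferInstance, ?_, ?_⟩
  · rw [isPiGroup_iff] at *
    exact fun p hp hd => ⟨hp₁ p hp (hd.trans (Subgroup.card_dvd_of_le inf_le_left)),
      hp₂ p hp (hd.trans (Subgroup.card_dvd_of_le inf_le_right))⟩
  · intro p hp hd hps
    have := isPiNumber_index_inf (π := s₁ᶜ) (ρ := s₂ᶜ) hi₁ hi₂ p hp hd
    exact this.elim (fun h => h hps.1) (fun h => h hps.2)

lemma isSigmaNilpotent_of_encard_eq_one {G : Type*} [Group G] {P : Set ℕ} {σ : Partition P}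
    (hG : primesOf G ⊆ P) (h : (σ : Set (Set ℕ)).encard = 1) : IsSigmaNilpotent G σ := by
  intro s hs
  obtain rfl := (eq_of_encard_eq_one h).2 s hs
  refine ⟨⊤, inferInstance, ?_, fun p hp hd => ?_⟩
  · rw [isPiGroup_iff, Subgroup.card_top, ← isPiGroup_iff]
    exact hG
  · rw [Subgroup.index_top] at hd
    exact absurd (Nat.dvd_one.1 hd) hp.ne_one

lemma isSigmaSoluble_inf {G : Type*} [Group G] [Finite G] {P : Set ℕ} {σ₁ σ₂ : Partition P}
    (h₁ : IsSigmaSoluble G σ₁) (h₂ : IsSigmaSoluble G σ₂) : IsSigmaSoluble G (σ₁ ⊓ σ₂) := by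
  intro A B _ hAB
  obtain ⟨s₁, hs₁, hp₁⟩ := h₁ A B hAB
  obtain ⟨s₂, hs₂, hp₂⟩ := h₂ A B hAB
  have hne : Nat.card (A ⧸ B.subgroupOf A) ≠ 1 := by
    change B.relIndex A ≠ 1
    rw [Ne, Subgroup.relIndex_eq_one]
    exact not_le_of_gt hAB.lt
  obtain ⟨p, hp, hd⟩ := Nat.exists_prime_and_dvd hne
  exact ⟨s₁ ∩ s₂, inter_mem_inf hs₁ hs₂ (hp₁ ⟨hp, hd⟩) (hp₂ ⟨hp, hd⟩),
    Set.subset_inter hp₁ hp₂⟩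

lemma isSigmaSoluble_of_encard_eq_one {G : Type*} [Group G] [Finite G] {P : Set ℕ}
    {σ : Partition P} (hG : primesOf G ⊆ P) (h : (σ : Set (Set ℕ)).encard = 1) :
    IsSigmaSoluble G σ :=
  fun A B _ _ => ⟨P, (eq_of_encard_eq_one h).1, fun _ hp => hG ⟨hp.1, hp.2.trans
    ((Subgroup.relIndex_dvd_card B A).trans A.card_subgroup_dvd_card)⟩⟩

/-! ### `σ`-subnormality -/

/-- One step of a `σ`-subnormal chain: `A` is normal in `B`, or `A` contains a normal subgroup `N`
of `B` such that `|B : N|` is an `s`-number for a block `s` of `σ`. -/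
def SubnormalStep {G : Type*} [Group G] {P : Set ℕ} (σ : Partition P) (A B : Subgroup G) : Prop :=
  A ≤ B ∧ (B ≤ Subgroup.normalizer (A : Set G) ∨
    ∃ s ∈ σ, ∃ N ≤ A, B ≤ Subgroup.normalizer (N : Set G) ∧ IsPiNumber s (N.relIndex B))

section SubnormalStep

variable {G G' : Type*} [Group G] [Group G'] {P : Set ℕ} {σ : Partition P} {A B H K : Subgroup G}

/-- The core is the largest admissible `N`, so its index divides that of any other. Allowing
arbitrary `N` makes the step visibly stable under images and preimages. -/
lemma subnormalStep_iff :
    SubnormalStep σ A B ↔ A ≤ B ∧ ((A.subgroupOf B).Normal ∨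
      ∃ s ∈ σ, IsPiGroup s (B ⧸ (A.subgroupOf B).normalCore)) := by
  refine and_congr_right fun hAB => or_congr
    (Subgroup.normal_subgroupOf_iff_le_normalizer hAB).symm
    (exists_congr fun s => and_congr_right fun _ => ?_)
  rw [isPiGroup_iff]
  constructor
  · rintro ⟨N, hNA, hN, hs⟩
    have : (N.subgroupOf B).Normal := Subgroup.normal_subgroupOf_of_le_normalizer hN
    refine hs.of_dvd (Subgroup.index_dvd_of_le (Subgroup.normal_le_normalCore.2 ?_))
    exact Subgroup.comap_mono hNA
  · intro hs
    have hle : (A.subgroupOf B).normalCore.map B.subtype ≤ B := Subgroup.map_subtype_le _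
    have heq : ((A.subgroupOf B).normalCore.map B.subtype).subgroupOf B =
        (A.subgroupOf B).normalCore :=
      Subgroup.comap_map_eq_self_of_injective B.subtype_injective _
    refine ⟨(A.subgroupOf B).normalCore.map B.subtype, ?_, ?_, ?_⟩
    · rw [Subgroup.map_le_iff_le_comap]
      exact Subgroup.normalCore_le _
    · rw [← Subgroup.normal_subgroupOf_iff_le_normalizer hle, heq]
      infer_instance
    · rw [Subgroup.relIndex, heq]
      exact hs

lemma SubnormalStep.comap (f : G' →* G) (h : SubnormalStep σ A B) :
    SubnormalStep σ (A.comap f) (B.comap f) := by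
  refine ⟨Subgroup.comap_mono h.1, h.2.imp (fun h => (Subgroup.comap_mono h).trans
    (Subgroup.le_normalizer_comap f)) ?_⟩
  rintro ⟨s, hs, N, hNA, hN, hi⟩
  refine ⟨s, hs, N.comap f, Subgroup.comap_mono hNA, (Subgroup.comap_mono hN).trans
    (Subgroup.le_normalizer_comap f), hi.of_dvd ?_⟩
  rw [Subgroup.relIndex_comap]
  exact relIndex_dvd_relIndex_of_le_normalizer hN (Subgroup.map_comap_le f B)

lemma SubnormalStep.map (f : G →* G') (h : SubnormalStep σ A B) :
    SubnormalStep σ (A.map f) (B.map f) := by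
  refine ⟨Subgroup.map_mono h.1, h.2.imp (fun h => (Subgroup.map_mono h).trans
    (Subgroup.le_normalizer_map f)) ?_⟩
  rintro ⟨s, hs, N, hNA, hN, hi⟩
  refine ⟨s, hs, N.map f, Subgroup.map_mono hNA, (Subgroup.map_mono hN).trans
    (Subgroup.le_normalizer_map f), hi.of_dvd ?_⟩
  rw [← Subgroup.relIndex_comap]
  exact Subgroup.relIndex_dvd_of_le_left B (Subgroup.le_comap_map f N)

/-- `H` is joined to `K` by a chain of `SubnormalStep`s. -/
abbrev SubnormalChain (σ : Partition P) (H K : Subgroup G) : Prop :=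
  Relation.ReflTransGen (SubnormalStep σ) H K

lemma SubnormalChain.le (h : SubnormalChain σ H K) : H ≤ K := by
  induction h with
  | refl => exact le_rfl
  | tail _ h ih => exact ih.trans h.1

lemma SubnormalChain.comap (f : G' →* G) (h : SubnormalChain σ H K) :
    SubnormalChain σ (H.comap f) (K.comap f) :=
  Relation.ReflTransGen.lift (Subgroup.comap f) (fun _ _ (h : SubnormalStep σ _ _) => h.comap f)
    _ _ h

lemma SubnormalChain.map (f : G →* G') (h : SubnormalChain σ H K) :
    SubnormalChain σ (H.map f) (K.map f) :=
  Relation.ReflTransGen.lift (Subgroup.map f) (fun _ _ (h : SubnormalStep σ _ _) => h.map f) _ _ h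

lemma isSigmaSubnormal_iff : IsSigmaSubnormal H σ ↔ SubnormalChain σ H ⊤ := by
  constructor
  · rintro ⟨n, C, rfl, hn, hC⟩
    rw [← hn]
    have : ∀ i ≤ n, SubnormalChain σ (C 0) (C i) := by
      intro i
      induction i with
      | zero => exact fun _ => Relation.ReflTransGen.refl
      | succ i ih => exact fun hi => (ih (by omega)).tail (subnormalStep_iff.2 (hC i hi))
    exact this n le_rfl
  · intro h
    induction h using Relation.ReflTransGen.head_induction_on with
    | refl => exact ⟨0, fun _ => ⊤, rfl, rfl, by simp⟩
    | @head A B h _ ih =>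
      obtain ⟨n, C, h0, hn, hC⟩ := ih
      refine ⟨n + 1, fun k => k.casesOn A C, rfl, hn, fun i hi => ?_⟩
      rw [← subnormalStep_iff]
      cases i with
      | zero => simpa [h0] using h
      | succ i => exact subnormalStep_iff.2 (hC i (by omega))

lemma SubnormalChain.eq_top_or_exists_step (h : SubnormalChain σ H ⊤) :
    H = ⊤ ∨ ∃ M, M ≠ ⊤ ∧ H ≤ M ∧ SubnormalStep σ M ⊤ := by
  induction h using Relation.ReflTransGen.head_induction_on with
  | refl => exact .inl rfl
  | @head A B h _ ih =>
    by_cases hA : A = ⊤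
    · exact .inl hA
    · rcases ih with rfl | ⟨M, hM, hBM, hs⟩
      · exact .inr ⟨A, hA, le_rfl, h⟩
      · exact .inr ⟨M, hM, h.1.trans hBM, hs⟩

lemma SubnormalChain.of_subgroupOf {M : Subgroup G} (hHM : H ≤ M)
    (h : SubnormalChain σ (H.subgroupOf M) ⊤) : SubnormalChain σ H M := by
  have := h.map M.subtype
  rwa [Subgroup.subgroupOf_map_subtype, inf_eq_left.2 hHM, ← MonoidHom.range_eq_map,
    Subgroup.range_subtype] at this

/-- All indices are `s`-numbers, so a step for a block `t` of `σ₂` is a step for `s ∩ t`. When the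
index is `1` the intersection may be empty, but then the step is trivial and counts as normal. -/
lemma SubnormalChain.inf_of_isPiNumber_card {σ₁ σ₂ : Partition P} {s : Set ℕ}
    (hs : s ∈ σ₁) (hG : IsPiNumber s (Nat.card G)) (h : SubnormalChain σ₂ H K) :
    SubnormalChain (σ₁ ⊓ σ₂) H K := by
  refine Relation.ReflTransGen.mono ?_ _ _ h
  rintro A B ⟨hAB, hn | ⟨t, ht, N, hNA, hN, hi⟩⟩
  · exact ⟨hAB, .inl hn⟩
  refine ⟨hAB, ?_⟩
  by_cases h1 : N.relIndex B = 1
  · exact .inl (((Subgroup.relIndex_eq_one.1 h1).trans hNA).trans Subgroup.le_normalizer)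
  have hs' : IsPiNumber s (N.relIndex B) :=
    hG.of_dvd ((Subgroup.relIndex_dvd_card N B).trans B.card_subgroup_dvd_card)
  obtain ⟨p, hp, hd⟩ := Nat.exists_prime_and_dvd h1
  exact .inr ⟨s ∩ t, inter_mem_inf hs ht (hs' p hp hd) (hi p hp hd), N, hNA, hN,
    fun p hp hd => ⟨hs' p hp hd, hi p hp hd⟩⟩

end SubnormalStep

lemma SubnormalChain.inf {P : Set ℕ} {σ₁ σ₂ : Partition P} (n : ℕ) :
    ∀ (G : Type u) [Group G] [Finite G] (_ : Nat.card G = n) (H : Subgroup G),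
      SubnormalChain σ₁ H ⊤ → SubnormalChain σ₂ H ⊤ → SubnormalChain (σ₁ ⊓ σ₂) H ⊤ := by
  induction n using Nat.strong_induction_on with
  | _ n ih =>
  intro G _ _ hn H h₁ h₂
  have key : ∀ M : Subgroup G, M ≠ ⊤ → H ≤ M → SubnormalChain (σ₁ ⊓ σ₂) H M := by
    intro M hM hHM
    refine .of_subgroupOf hHM (ih (Nat.card M) (hn ▸ card_subgroup_lt_card hM) M rfl _ ?_ ?_)
    · exact SubnormalChain.comap M.subtype h₁
    · exact SubnormalChain.comap M.subtype h₂
  obtain rfl | ⟨M, hM, hHM, -, hn | ⟨s, hs, N, hNM, hN, hi⟩⟩ := h₁.eq_top_or_exists_step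
  · exact .refl
  · exact (key M hM hHM).tail ⟨le_top, .inl hn⟩
  · have : N.Normal := Subgroup.normalizer_eq_top_iff.1 (top_le_iff.1 hN)
    rw [Subgroup.relIndex_top_right] at hi
    -- Pulled back from `G / N`, this becomes a chain from `HN` to `G`.
    have hq : SubnormalChain (σ₁ ⊓ σ₂) (H.map (QuotientGroup.mk' N)) ⊤ := by
      refine SubnormalChain.inf_of_isPiNumber_card hs hi ?_
      rw [← Subgroup.map_top_of_surjective _ (QuotientGroup.mk'_surjective N)]
      exact h₂.map _
    have hq' := hq.comap (QuotientGroup.mk' N)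
    rw [Subgroup.comap_map_eq, QuotientGroup.ker_mk', Subgroup.comap_top] at hq'
    exact (key _ (ne_top_of_le_ne_top hM (sup_le hHM hNM)) le_sup_left).trans hq'

lemma isSigmaSubnormal_inf {G : Type u} [Group G] [Finite G] {H : Subgroup G} {P : Set ℕ}
    {σ₁ σ₂ : Partition P} (h₁ : IsSigmaSubnormal H σ₁) (h₂ : IsSigmaSubnormal H σ₂) :
    IsSigmaSubnormal H (σ₁ ⊓ σ₂) :=
  isSigmaSubnormal_iff.2 (SubnormalChain.inf _ G rfl H (isSigmaSubnormal_iff.1 h₁)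
    (isSigmaSubnormal_iff.1 h₂))

lemma isSigmaSubnormal_of_encard_eq_one {G : Type*} [Group G] {H : Subgroup G} {P : Set ℕ}
    {σ : Partition P} (hG : primesOf G ⊆ P) (h : (σ : Set (Set ℕ)).encard = 1) :
    IsSigmaSubnormal H σ := by
  refine isSigmaSubnormal_iff.2 (.single ⟨le_top, .inr ⟨P, (eq_of_encard_eq_one h).1, ⊥, bot_le,
    ?_, ?_⟩⟩)
  · rw [Subgroup.normalizer_eq_top]
  · rw [Subgroup.relIndex_bot_left, Subgroup.card_top]
    exact isPiGroup_iff.1 hG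

/-! ### Projectors -/

section Projector

variable {G : Type*} [Group G] {π : Set ℕ}

/-- Projectors described by indices of subgroups of `G`, without quotient groups. -/
lemma isPiProjector_iff {A : Subgroup G} :
    IsPiProjector π A ↔ IsPiNumber π (Nat.card A) ∧
      ∀ (K : Subgroup G) [K.Normal] (D : Subgroup G), A ≤ D → K ≤ D →
        IsPiNumber π (K.relIndex D) → D ≤ A ⊔ K := by
  have hcard : ∀ (K : Subgroup G) [K.Normal] (D : Subgroup G),
      Nat.card (D.map (QuotientGroup.mk' K)) = K.relIndex D := fun K _ D => by
    rw [← Subgroup.relIndex_ker, QuotientGroup.ker_mk']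
  have hcomap : ∀ (K : Subgroup G) [K.Normal] (D : Subgroup G),
      (D.map (QuotientGroup.mk' K)).comap (QuotientGroup.mk' K) = D ⊔ K := fun K _ D => by
    rw [Subgroup.comap_map_eq, QuotientGroup.ker_mk']
  constructor
  · intro h
    refine ⟨?_, fun K _ D hA _ hi => ?_⟩
    · have := isPiGroup_iff.1 (h ⊥).prop
      rwa [hcard, Subgroup.relIndex_bot_left] at this
    · have := (h K).le_of_ge (y := D.map (QuotientGroup.mk' K))
        (isPiGroup_iff.2 ((hcard K D).symm ▸ hi)) (Subgroup.map_mono hA)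
      rwa [Subgroup.map_le_iff_le_comap, hcomap] at this
  · rintro ⟨hA, h⟩ K _
    refine ⟨isPiGroup_iff.2 ((hcard K A).symm ▸ hA.of_dvd (Subgroup.relIndex_dvd_card K A)),
      fun D hD hAD => ?_⟩
    have hmap : (D.comap (QuotientGroup.mk' K)).map (QuotientGroup.mk' K) = D :=
      Subgroup.map_comap_eq_self_of_surjective (QuotientGroup.mk'_surjective K) D
    have hK : K ≤ D.comap (QuotientGroup.mk' K) := by
      conv_lhs => rw [← QuotientGroup.ker_mk' K]
      exact Subgroup.ker_le_comap _ _
    have := h K (D.comap (QuotientGroup.mk' K)) (Subgroup.map_le_iff_le_comap.1 hAD) hK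
      (by rw [← hcard, hmap]; exact isPiGroup_iff.1 hD)
    rw [← hcomap] at this
    change D ≤ _
    rw [← hmap, Subgroup.map_le_iff_le_comap]
    exact this

/-- Used for the automorphisms that elements of `G` induce on a normal subgroup `R`, so that
`G`-conjugates of projectors of `R` are again projectors of `R`. -/
lemma IsPiProjector.map_mulEquiv {G' : Type*} [Group G'] {A : Subgroup G} (h : IsPiProjector π A)
    (e : G ≃* G') : IsPiProjector π (A.map e.toMonoidHom) := by
  rw [isPiProjector_iff] at h ⊢
  refine ⟨?_, fun K _ D hA hK hi => ?_⟩
  · rw [Subgroup.card_map_of_injective e.injective]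
    exact h.1
  · have hm : ∀ D : Subgroup G', (D.comap e.toMonoidHom).map e.toMonoidHom = D := fun D =>
      Subgroup.map_comap_eq_self_of_surjective e.surjective D
    have := h.2 (K.comap e.toMonoidHom) (D.comap e.toMonoidHom) (Subgroup.map_le_iff_le_comap.1 hA)
      (Subgroup.comap_mono hK) (by rw [Subgroup.relIndex_comap, hm]; exact hi)
    have := Subgroup.map_mono (f := e.toMonoidHom) this
    rwa [Subgroup.map_sup, hm, hm] at this

/-- The defining property of a projector of a subgroup `E` of `G`, for subgroups of `G`. -/
lemma IsPiProjector.inf_le {E K D : Subgroup G} {A : Subgroup E} (h : IsPiProjector π A)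
    (hE : E ≤ Subgroup.normalizer (K : Set G)) (hA : A.map E.subtype ≤ D) (hK : K ⊓ E ≤ D)
    (hi : IsPiNumber π (K.relIndex (D ⊓ E))) : D ⊓ E ≤ A.map E.subtype ⊔ K := by
  have : (K.subgroupOf E).Normal := Subgroup.normal_subgroupOf_of_le_normalizer hE
  have := (isPiProjector_iff.1 h).2 (K.subgroupOf E) (D.subgroupOf E)
    (Subgroup.map_le_iff_le_comap.1 hA) (fun x hx => hK ⟨hx, x.2⟩)
    (by rw [Subgroup.subgroupOf, Subgroup.relIndex_comap, Subgroup.subgroupOf_map_subtype]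
        exact hi)
  have := Subgroup.map_mono (f := E.subtype) this
  rw [Subgroup.map_sup, Subgroup.subgroupOf_map_subtype, Subgroup.subgroupOf_map_subtype] at this
  exact this.trans (sup_le_sup_left inf_le_left _)

/-- A projector of a projector modulo `N` is a projector. -/
lemma IsPiProjector.of_quotient {N E : Subgroup G} [N.Normal] (hNE : N ≤ E)
    (hE : IsPiProjector π (E.map (QuotientGroup.mk' N))) {A : Subgroup E}
    (hA : IsPiProjector π A) : IsPiProjector π (A.map E.subtype) := by
  have hAE : A.map E.subtype ≤ E := Subgroup.map_subtype_le A
  rw [isPiProjector_iff] at hE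
  obtain ⟨hE₁, hE₂⟩ := hE
  rw [← Subgroup.relIndex_ker, QuotientGroup.ker_mk'] at hE₁
  -- `E / N` is itself a `π`-group, so the projector `A` of `E` covers it.
  have hsup : E ≤ A.map E.subtype ⊔ N := by
    have := hA.inf_le (K := N) (D := E) Subgroup.le_normalizer_of_normal hAE
      (inf_le_left.trans hNE) (by rwa [inf_idem])
    rwa [inf_idem] at this
  refine isPiProjector_iff.2 ⟨?_, fun K _ D hAD hKD hi => ?_⟩
  · rw [Subgroup.card_subtype]
    exact (isPiProjector_iff.1 hA).1
  have h₁ : D ≤ E ⊔ K := by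
    have : (K.map (QuotientGroup.mk' N)).Normal :=
      Subgroup.Normal.map inferInstance _ (QuotientGroup.mk'_surjective N)
    have hED : E.map (QuotientGroup.mk' N) ≤ D.map (QuotientGroup.mk' N) := by
      rw [Subgroup.map_le_iff_le_comap, Subgroup.comap_map_eq, QuotientGroup.ker_mk']
      exact hsup.trans (sup_le_sup_right hAD _)
    have := hE₂ (K.map (QuotientGroup.mk' N)) (D.map (QuotientGroup.mk' N)) hED
      (Subgroup.map_mono hKD) (hi.of_dvd (by
        rw [← Subgroup.relIndex_comap]
        exact Subgroup.relIndex_dvd_of_le_left D (Subgroup.le_comap_map _ K)))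
    rw [← Subgroup.map_sup, Subgroup.map_le_iff_le_comap, Subgroup.comap_map_eq,
      QuotientGroup.ker_mk'] at this
    exact this.trans (sup_le le_rfl (hNE.trans le_sup_left))
  have h₂ : D ⊓ E ≤ A.map E.subtype ⊔ K :=
    hA.inf_le Subgroup.le_normalizer_of_normal hAD (inf_le_left.trans hKD)
      (hi.of_dvd (relIndex_dvd_relIndex_of_le_normalizer Subgroup.le_normalizer_of_normal
        inf_le_left))
  -- Dedekind's law: as `K ≤ D ≤ EK`, the `E`-part of an element of `D` lies in `D ∩ E`.
  intro d hd
  obtain ⟨e, he, k, hk, rfl⟩ := Subgroup.mem_sup_of_normal_right.1 (h₁ hd)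
  exact mul_mem (h₂ ⟨(Subgroup.mul_mem_cancel_right D (hKD hk)).1 hd, he⟩)
    (Subgroup.mem_sup_right hk)

/-- A projector of a normal subgroup whose index is a `π'`-number is a projector of `G`. -/
lemma IsPiProjector.of_normal {R : Subgroup G} [R.Normal] (hR : IsPiNumber πᶜ R.index)
    {A : Subgroup R} (hA : IsPiProjector π A) : IsPiProjector π (A.map R.subtype) := by
  refine isPiProjector_iff.2 ⟨?_, fun K _ D hAD hKD hi => ?_⟩
  · rw [Subgroup.card_subtype]
    exact (isPiProjector_iff.1 hA).1
  have h₁ : D ⊓ R ≤ A.map R.subtype ⊔ K :=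
    hA.inf_le Subgroup.le_normalizer_of_normal hAD (inf_le_left.trans hKD)
      (hi.of_dvd (relIndex_dvd_relIndex_of_le_normalizer Subgroup.le_normalizer_of_normal
        inf_le_left))
  -- The index divides both the `π`-number `|D : K|` and the `π'`-number `|D : D ∩ R|`.
  have h₂ : (K ⊔ D ⊓ R).relIndex D = 1 := by
    refine IsPiNumber.eq_one (hi.of_dvd (Subgroup.relIndex_dvd_of_le_left D le_sup_left))
      (hR.of_dvd ((Subgroup.relIndex_dvd_of_le_left D le_sup_right).trans ?_))
    rw [Subgroup.inf_relIndex_left]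
    exact Subgroup.relIndex_dvd_index_of_normal R D
  exact (Subgroup.relIndex_eq_one.1 h₂).trans (sup_le le_sup_right h₁)

/-- The image of `A` in `G / N` is trivial, so by maximality `G / N` has no subgroup of order `p`
with `p ∈ π`. -/
lemma IsPiProjector.isPiNumber_compl_index [Finite G] {A N : Subgroup G} [N.Normal] (hA : IsPiProjector π A)
    (hAN : A ≤ N) : IsPiNumber πᶜ N.index := by
  intro p hp hd hpπ
  have : Fact p.Prime := ⟨hp⟩
  obtain ⟨x, hx⟩ := exists_prime_orderOf_dvd_card' (G := G ⧸ N) p hd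
  have hbot : A.map (QuotientGroup.mk' N) = ⊥ := by
    rwa [Subgroup.map_eq_bot_iff, QuotientGroup.ker_mk']
  have hz : IsPiGroup π (Subgroup.zpowers x) := by
    rw [isPiGroup_iff, Nat.card_zpowers, hx]
    intro q hq hqp
    rwa [(Nat.prime_dvd_prime_iff_eq hq hp).1 hqp]
  have := (hA N).le_of_ge hz (hbot ▸ bot_le)
  rw [hbot, le_bot_iff, Subgroup.zpowers_eq_bot] at this
  rw [this, orderOf_one] at hx
  exact hp.ne_one hx.symm

end Projector

/-! ### Supplements and the existence of projectors. -/

/-- If a prime outside `π` divides `|G|` and `G / N` is a `π`-group, then `N` has a proper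
supplement. -/
lemma exists_proper_supplement {G : Type*} [Group G] [Finite G] {π : Set ℕ} {N : Subgroup G}
    [N.Normal] (hN : IsPiNumber π N.index) (hG : ¬ IsPiNumber π (Nat.card G)) :
    ∃ M : Subgroup G, M ≠ ⊤ ∧ M ⊔ N = ⊤ := by
  simp only [IsPiNumber, not_forall] at hG
  obtain ⟨p, hp, hd, hpπ⟩ := hG
  have : Fact p.Prime := ⟨hp⟩
  have hpi : ¬ p ∣ N.index := fun h => hpπ (hN p hp h)
  have hpN : p ∣ Nat.card N := by
    rw [← N.card_mul_index] at hd
    exact (hp.dvd_mul.1 hd).resolve_right hpi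
  let S : Sylow p N := default
  let Q : Subgroup G := (S : Subgroup N).map N.subtype
  have hQN : Q ≤ N := Subgroup.map_subtype_le _
  -- If `Q` is not normal in `G`, its normalizer supplements `N` by the Frattini argument. Otherwise
  -- `Q` is a nontrivial normal Sylow subgroup of `G`, and Schur–Zassenhaus gives a proper
  -- complement.
  by_cases hM : Subgroup.normalizer (Q : Set G) = ⊤
  · have hQ : Q.Normal := Subgroup.normalizer_eq_top_iff.1 hM
    have hcard : Nat.card Q = Nat.card S := Subgroup.card_subtype N S
    have hsub : Q.subgroupOf N = S :=
      Subgroup.comap_map_eq_self_of_injective N.subtype_injective _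
    have hindex : ¬ p ∣ Q.index := by
      rw [← Subgroup.relIndex_mul_index hQN, hp.dvd_mul, Subgroup.relIndex, hsub]
      exact not_or.2 ⟨S.not_dvd_index, hpi⟩
    have hc : (Nat.card Q).Coprime Q.index := by
      obtain ⟨k, hk⟩ := IsPGroup.iff_card.1 S.isPGroup'
      rw [hcard, hk]
      exact Nat.Coprime.pow_left k ((Nat.Prime.coprime_iff_not_dvd hp).2 hindex)
    obtain ⟨K, hK⟩ := Subgroup.exists_right_complement'_of_coprime hc
    refine ⟨K, fun h => ?_, ?_⟩
    · have h1 : Q = ⊥ := by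
        have := hK.disjoint
        rwa [h, disjoint_top] at this
      rw [h1, Subgroup.card_bot] at hcard
      have := (S.dvd_card_of_dvd_card hpN)
      rw [← hcard] at this
      exact hp.ne_one (Nat.dvd_one.1 this)
    · rw [eq_top_iff, ← hK.sup_eq_top]
      exact sup_le (hQN.trans le_sup_right) le_sup_left
  · exact ⟨_, hM, S.normalizer_sup_eq_top⟩

/-- If `G / N` is a `π`-group, then `N` has a supplement in `G` that is a `π`-group. -/
lemma exists_isPiNumber_supplement {π : Set ℕ} (n : ℕ) :
    ∀ (G : Type u) [Group G] [Finite G] (_ : Nat.card G = n) (N : Subgroup G) [N.Normal],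
      IsPiNumber π N.index → ∃ A : Subgroup G, IsPiNumber π (Nat.card A) ∧ A ⊔ N = ⊤ := by
  induction n using Nat.strong_induction_on with
  | _ n ih =>
  intro G _ _ hn N _ hN
  by_cases hG : IsPiNumber π (Nat.card G)
  · exact ⟨⊤, by rwa [Subgroup.card_top], top_sup_eq N⟩
  obtain ⟨M, hM, hMN⟩ := exists_proper_supplement hN hG
  obtain ⟨A, hA, hAN⟩ := ih (Nat.card M) (hn ▸ card_subgroup_lt_card hM) M rfl (N.subgroupOf M)
    (hN.of_dvd (Subgroup.relIndex_dvd_index_of_normal N M))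
  refine ⟨A.map M.subtype, ?_, ?_⟩
  · rwa [Subgroup.card_subtype]
  · have := congrArg (Subgroup.map M.subtype) hAN
    rw [Subgroup.map_sup, Subgroup.subgroupOf_map_subtype, ← MonoidHom.range_eq_map,
      Subgroup.range_subtype] at this
    rw [eq_top_iff, ← hMN]
    refine sup_le ?_ le_sup_right
    conv_lhs => rw [← this]
    exact sup_le_sup_left inf_le_left _

lemma exists_minimal_normal (G : Type*) [Group G] [Finite G] [Nontrivial G] :
    ∃ N : Subgroup G, Minimal (fun N : Subgroup G => N.Normal ∧ N ≠ ⊥) N :=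
  (Set.toFinite {N : Subgroup G | N.Normal ∧ N ≠ ⊥}).exists_minimal
    ⟨⊤, inferInstance, top_ne_bot⟩

/-- A maximal `π`-subgroup that supplements a minimal normal subgroup is a projector. -/
lemma isPiProjector_of_maximal {G : Type*} [Group G] [Finite G] {π : Set ℕ} {N A : Subgroup G}
    [N.Normal] (hN : ∀ K : Subgroup G, K.Normal → K ≤ N → K = ⊥ ∨ K = N)
    (hA : Maximal (fun A : Subgroup G => IsPiNumber π (Nat.card A)) A)
    (hi : IsPiNumber π N.index) (hAN : A ⊔ N = ⊤) : IsPiProjector π A := by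
  refine isPiProjector_iff.2 ⟨hA.prop, fun K _ D hAD hKD hD => ?_⟩
  -- If `K ∩ N = 1`, then `D ∩ N` embeds in `D / K` and `D / (D ∩ N)` in `G / N`, so `D` is a
  -- `π`-group and equals `A`. If `N ≤ K`, then `AK = G`.
  rcases hN (K ⊓ N) inferInstance inf_le_right with h | h
  · refine (hA.le_of_ge ?_ hAD).trans le_sup_left
    have h₁ : IsPiNumber π (Nat.card (D ⊓ N : Subgroup G)) := by
      have : K.relIndex (D ⊓ N) = Nat.card (D ⊓ N : Subgroup G) := by
        rw [← Subgroup.inf_relIndex_right, ← inf_assoc, inf_right_comm, h, bot_inf_eq,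
          Subgroup.relIndex_bot_left]
      rw [← this]
      exact hD.of_dvd (relIndex_dvd_relIndex_of_le_normalizer Subgroup.le_normalizer_of_normal
        inf_le_left)
    have h₂ : IsPiNumber π ((D ⊓ N).relIndex D) := by
      rw [Subgroup.inf_relIndex_left]
      exact hi.of_dvd (Subgroup.relIndex_dvd_index_of_normal N D)
    rw [← Subgroup.relIndex_bot_left, ← Subgroup.relIndex_mul_relIndex ⊥ (D ⊓ N) D bot_le
      inf_le_left, Subgroup.relIndex_bot_left]
    exact h₁.mul h₂
  · rw [inf_eq_right] at h
    refine le_top.trans (hAN.symm.le.trans (sup_le_sup_left h A))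

theorem exists_isPiProjector_of_card (π : Set ℕ) (n : ℕ) :
    ∀ (G : Type u) [Group G] [Finite G] (_ : Nat.card G = n),
      ∃ A : Subgroup G, IsPiProjector π A := by
  induction n using Nat.strong_induction_on with
  | _ n ih =>
  intro G _ _ hn
  rcases subsingleton_or_nontrivial G with _ | _
  · refine ⟨⊤, isPiProjector_iff.2 ⟨?_, fun _ _ _ _ _ _ => by simp⟩⟩
    rw [Nat.card_of_subsingleton 1]
    exact IsPiNumber.one
  obtain ⟨N, ⟨hN, hNb⟩, hmin⟩ := exists_minimal_normal G
  have hcard : Nat.card (G ⧸ N) < n := by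
    rw [← hn, N.card_eq_card_quotient_mul_card_subgroup]
    exact lt_mul_of_one_lt_right Nat.card_pos (N.one_lt_card_iff_ne_bot.2 hNb)
  obtain ⟨E', hE'⟩ := ih _ hcard (G ⧸ N) rfl
  obtain ⟨E, hNE, rfl⟩ : ∃ E : Subgroup G, N ≤ E ∧ E.map (QuotientGroup.mk' N) = E' := by
    refine ⟨E'.comap (QuotientGroup.mk' N), ?_,
      Subgroup.map_comap_eq_self_of_surjective (QuotientGroup.mk'_surjective N) E'⟩
    conv_lhs => rw [← QuotientGroup.ker_mk' N]
    exact Subgroup.ker_le_comap _ _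
  by_cases hE : E = ⊤
  · subst hE
    have hi : IsPiNumber π N.index := by
      have := (isPiProjector_iff.1 hE').1
      rwa [← Subgroup.relIndex_ker, QuotientGroup.ker_mk', Subgroup.relIndex_top_right] at this
    obtain ⟨A₀, hA₀, hA₀N⟩ := exists_isPiNumber_supplement n G hn N hi
    obtain ⟨A, hle, hA⟩ := Finite.exists_le_maximal
      (p := fun A : Subgroup G => IsPiNumber π (Nat.card A)) hA₀
    refine ⟨A, isPiProjector_of_maximal (fun K hK hKN => ?_) hA hi
      (top_le_iff.1 (hA₀N.symm.le.trans (sup_le_sup_right hle N)))⟩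
    by_cases hKb : K = ⊥
    · exact .inl hKb
    · exact .inr (le_antisymm hKN (hmin ⟨hK, hKb⟩ hKN))
  · obtain ⟨A, hA⟩ := ih _ (hn ▸ card_subgroup_lt_card hE) E rfl
    exact ⟨_, IsPiProjector.of_quotient hNE hE' hA⟩

/-- Every finite group has a projector for the class of `π`-groups. -/
theorem exists_isPiProjector (π : Set ℕ) (G : Type u) [Group G] [Finite G] :
    ∃ A : Subgroup G, IsPiProjector π A :=
  exists_isPiProjector_of_card π _ G rfl

/-! ### Permuting subgroups -/

section Permutes

open scoped Pointwise

variable {G : Type*} [Group G]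

/-- The subgroups `H` and `X` permute: `H X = X H`. -/
def Permutes (H X : Subgroup G) : Prop :=
  (H : Set G) * (X : Set G) = (X : Set G) * (H : Set G)

lemma permutes_iff {H X : Subgroup G} :
    Permutes H X ↔ ∀ h ∈ H, ∀ x ∈ X, ∃ x' ∈ X, ∃ h' ∈ H, h * x = x' * h' := by
  constructor
  · intro hp h hh x hx
    have : h * x ∈ (X : Set G) * (H : Set G) := hp ▸ Set.mul_mem_mul hh hx
    obtain ⟨x', hx', h', hh', he⟩ := Set.mem_mul.1 this
    exact ⟨x', hx', h', hh', he.symm⟩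
  · intro hp
    refine Set.Subset.antisymm ?_ ?_
    · rintro _ ⟨h, hh, x, hx, rfl⟩
      obtain ⟨x', hx', h', hh', he⟩ := hp h hh x hx
      exact Set.mem_mul.2 ⟨x', hx', h', hh', he.symm⟩
    · rintro _ ⟨x, hx, h, hh, rfl⟩
      obtain ⟨x', hx', h', hh', he⟩ := hp h⁻¹ (inv_mem hh) x⁻¹ (inv_mem hx)
      refine Set.mem_mul.2 ⟨h'⁻¹, inv_mem hh', x'⁻¹, inv_mem hx', ?_⟩
      rw [← mul_inv_rev, ← he, mul_inv_rev, inv_inv, inv_inv]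

lemma Permutes.sup {H K X : Subgroup G} (hH : Permutes H X) (hK : Permutes K X) :
    Permutes (H ⊔ K) X := by
  rw [permutes_iff] at *
  have hgen : ∀ g ∈ (H : Set G) ∪ (K : Set G), ∀ x ∈ X,
      ∃ x' ∈ X, ∃ h' ∈ H ⊔ K, g * x = x' * h' := by
    rintro g (hg | hg) x hx
    · obtain ⟨x', hx', h', hh', he⟩ := hH g hg x hx
      exact ⟨x', hx', h', Subgroup.mem_sup_left hh', he⟩
    · obtain ⟨x', hx', h', hh', he⟩ := hK g hg x hx
      exact ⟨x', hx', h', Subgroup.mem_sup_right hh', he⟩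
  have hstep : ∀ g ∈ (H : Set G) ∪ (K : Set G), ∀ k,
      (∀ x ∈ X, ∃ x' ∈ X, ∃ h' ∈ H ⊔ K, k * x = x' * h') →
      ∀ x ∈ X, ∃ x' ∈ X, ∃ h' ∈ H ⊔ K, g * k * x = x' * h' := by
    intro g hg k hk x hx
    obtain ⟨x₁, hx₁, h₁, hh₁, he₁⟩ := hk x hx
    obtain ⟨x₂, hx₂, h₂, hh₂, he₂⟩ := hgen g hg x₁ hx₁
    exact ⟨x₂, hx₂, h₂ * h₁, mul_mem hh₂ hh₁, by rw [mul_assoc, he₁, ← mul_assoc, he₂, mul_assoc]⟩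
  intro k hk
  rw [Subgroup.sup_eq_closure] at hk
  induction hk using Subgroup.closure_induction_left with
  | one => exact fun x hx => ⟨x, hx, 1, one_mem _, by simp⟩
  | mul_left g hg k _ ih => exact hstep g hg k ih
  | inv_mul_cancel g hg k _ ih =>
    exact hstep g⁻¹ (hg.imp (fun h => H.inv_mem h) (fun h => K.inv_mem h)) k ih

lemma Permutes.exists_of_mem_sup {H X : Subgroup G} (h : Permutes H X) {k : G} (hk : k ∈ H ⊔ X) :
    ∃ x ∈ X, ∃ t ∈ H, k = x * t := by
  rw [permutes_iff] at h
  have hstep : ∀ g ∈ (H : Set G) ∪ (X : Set G), ∀ k, (∃ x ∈ X, ∃ t ∈ H, k = x * t) →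
      ∃ x ∈ X, ∃ t ∈ H, g * k = x * t := by
    rintro g (hg | hg) k ⟨x, hx, t, ht, rfl⟩
    · obtain ⟨x', hx', h', hh', he⟩ := h g hg x hx
      exact ⟨x', hx', h' * t, mul_mem hh' ht, by rw [← mul_assoc, he, mul_assoc]⟩
    · exact ⟨g * x, mul_mem hg hx, t, ht, by rw [mul_assoc]⟩
  rw [Subgroup.sup_eq_closure] at hk
  induction hk using Subgroup.closure_induction_left with
  | one => exact ⟨1, one_mem _, 1, one_mem _, by simp⟩
  | mul_left g hg k _ ih => exact hstep g hg k ih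
  | inv_mul_cancel g hg k _ ih =>
    exact hstep g⁻¹ (hg.imp (fun h => H.inv_mem h) (fun h => X.inv_mem h)) k ih

lemma Permutes.map {H X : Subgroup G} (h : Permutes H X) (f : G →* G) :
    Permutes (H.map f) (X.map f) := by
  unfold Permutes at *
  rw [Subgroup.coe_map, Subgroup.coe_map, ← Set.image_mul, h, Set.image_mul]

/-- Each `h` is `x₁u`, and `x₁u · x = (x₁x)(x⁻¹ux)` with `x⁻¹ux ∈ U ≤ H`. -/
lemma permutes_of_le_sup {U H X : Subgroup G} (hUH : U ≤ H) (hH : H ≤ X ⊔ U)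
    (hX : X ≤ Subgroup.normalizer (U : Set G)) : Permutes H X := by
  refine permutes_iff.2 fun h hh x hx => ?_
  have hm : h ∈ (X : Set G) * (U : Set G) := by
    rw [← Subgroup.coe_mul_of_left_le_normalizer_right X U hX]
    exact hH hh
  obtain ⟨x₁, hx₁, u, hu, rfl⟩ := Set.mem_mul.1 hm
  refine ⟨x₁ * x, mul_mem hx₁ hx, x⁻¹ * u * x, hUH ?_, by group⟩
  have := (Subgroup.mem_normalizer_iff.1 (inv_mem (hX hx)) u).1 hu
  rwa [inv_inv] at this

lemma conj_map_conj_inv (X : Subgroup G) (g : G) :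
    (X.map (MulAut.conj g⁻¹).toMonoidHom).map (MulAut.conj g).toMonoidHom = X := by
  ext y
  simp [Subgroup.mem_map, mul_assoc]

lemma mem_normalizer_of_forall_conj_mem {T : Subgroup G} {X : Subgroup G}
    (h : ∀ a ∈ X, T.map (MulAut.conj a).toMonoidHom ≤ T) :
    X ≤ Subgroup.normalizer (T : Set G) := by
  intro a ha
  refine Subgroup.mem_normalizer_iff.2 fun t => ⟨fun ht => h a ha ⟨t, ht, rfl⟩, fun ht => ?_⟩
  have := h a⁻¹ (inv_mem ha) ⟨_, ht, rfl⟩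
  simpa [mul_assoc] using this

/-- If `H` permutes with every member of a conjugation-invariant family of `π`-subgroups, then
`H` lies with `π`-index in a subgroup normalized by all of them. -/
lemma exists_normalized_of_permutes [Finite G] {π : Set ℕ} {𝒳 : Set (Subgroup G)} {H : Subgroup G}
    (hπ : ∀ X ∈ 𝒳, IsPiNumber π (Nat.card X))
    (hconj : ∀ X ∈ 𝒳, ∀ g : G, X.map (MulAut.conj g).toMonoidHom ∈ 𝒳)
    (hH : ∀ X ∈ 𝒳, Permutes H X) :
    ∃ T : Subgroup G, H ≤ T ∧ IsPiNumber π (H.relIndex T) ∧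
      ∀ X ∈ 𝒳, X ≤ Subgroup.normalizer (T : Set G) := by
  -- A maximal `T` is normalized: for `a ∈ X` the join of `T` with its conjugate by `a` lies in
  -- `TX`, so its index over `T` divides `|X : X ∩ T|`, and it still permutes with the
  -- conjugation-invariant family.
  obtain ⟨T, -, hT⟩ := Finite.exists_le_maximal (a := H)
    (p := fun T : Subgroup G => H ≤ T ∧ IsPiNumber π (H.relIndex T) ∧ ∀ X ∈ 𝒳, Permutes T X)
    ⟨le_rfl, by rw [Subgroup.relIndex_self]; exact IsPiNumber.one, hH⟩
  obtain ⟨hHT, hi, hperm⟩ := hT.prop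
  refine ⟨T, hHT, hi, fun X hX => mem_normalizer_of_forall_conj_mem fun a ha => ?_⟩
  set T' := T.map (MulAut.conj a).toMonoidHom with hT'
  have hle : T ⊔ T' ≤ T ⊔ X := by
    refine sup_le le_sup_left ?_
    rintro _ ⟨t, ht, rfl⟩
    exact mul_mem (mul_mem (Subgroup.mem_sup_right ha) (Subgroup.mem_sup_left ht))
      (inv_mem (Subgroup.mem_sup_right ha))
  refine le_sup_right.trans (hT.le_of_ge ⟨hHT.trans le_sup_left, ?_, fun Y hY => ?_⟩ le_sup_left)
  · rw [← Subgroup.relIndex_mul_relIndex H T (T ⊔ T') hHT le_sup_left]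
    refine hi.mul ((hπ X hX).of_dvd (Dvd.dvd.trans ?_ (Subgroup.relIndex_dvd_card T X)))
    rw [← relIndex_eq_of_subset_mul (T := T) (K := T ⊔ X) le_sup_right
      fun k hk => (hperm X hX).exists_of_mem_sup hk]
    exact Dvd.intro _ (Subgroup.relIndex_mul_relIndex T (T ⊔ T') (T ⊔ X) le_sup_left hle)
  · refine (hperm Y hY).sup ?_
    have := (hperm _ (hconj Y hY a⁻¹)).map (MulAut.conj a).toMonoidHom
    rwa [conj_map_conj_inv] at this

lemma normal_sSup_of_conj_mem {𝒳 : Set (Subgroup G)}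
    (hconj : ∀ X ∈ 𝒳, ∀ g : G, X.map (MulAut.conj g).toMonoidHom ∈ 𝒳) : (sSup 𝒳).Normal := by
  refine ⟨fun x hx g => ?_⟩
  have : sSup 𝒳 ≤ (sSup 𝒳).comap (MulAut.conj g).toMonoidHom :=
    sSup_le fun X hX => Subgroup.map_le_iff_le_comap.1 (le_sSup (hconj X hX g))
  exact this hx

end Permutes

/-! ### `σ`-`p`-permutability -/

section PiCover

variable {G : Type*} [Group G] {π : Set ℕ} {H : Subgroup G}

/-- `H` is contained in a subgroup `T` that is normalized by a normal subgroup of `π'`-index of `G`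
and all of whose `p`-elements with `p ∉ π` lie in `H`. -/
def HasPiCover (π : Set ℕ) (H : Subgroup G) : Prop :=
  ∃ R T : Subgroup G, R.Normal ∧ IsPiNumber πᶜ R.index ∧ H ≤ T ∧
    R ≤ Subgroup.normalizer (T : Set G) ∧
    ∀ p : ℕ, p.Prime → p ∉ π → ∀ y ∈ T, (∃ k : ℕ, orderOf y = p ^ k) → y ∈ H

/-- A prime outside `π ∩ ρ` is outside `π` or outside `ρ`, so one of the two covers handles its
elements. This is why the definition speaks of elements of prime power order: a `(π ∩ ρ)'`-element
need be neither a `π'`-element nor a `ρ'`-element. -/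
lemma HasPiCover.inter {ρ : Set ℕ} (h₁ : HasPiCover π H) (h₂ : HasPiCover ρ H) :
    HasPiCover (π ∩ ρ) H := by
  obtain ⟨R₁, T₁, hn₁, hi₁, hH₁, hR₁, hT₁⟩ := h₁
  obtain ⟨R₂, T₂, hn₂, hi₂, hH₂, hR₂, hT₂⟩ := h₂
  refine ⟨R₁ ⊓ R₂, T₁ ⊓ T₂, inferInstance, ?_, le_inf hH₁ hH₂, ?_, fun p hp hpπ y hy hk => ?_⟩
  · rw [Set.compl_inter]
    exact isPiNumber_index_inf hi₁ hi₂
  · exact (inf_le_inf hR₁ hR₂).trans Subgroup.inf_normalizer_le_normalizer_inf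
  · by_cases h : p ∈ π
    · exact hT₂ p hp (fun h' => hpπ ⟨h, h'⟩) y hy.2 hk
    · exact hT₁ p hp h y hy.1 hk

lemma conjugate_one (A : Subgroup G) : conjugate A 1 = A := by
  ext; simp [conjugate, Subgroup.mem_map]

lemma conjugate_map_conj (A : Subgroup G) (x g : G) :
    (conjugate A x).map (MulAut.conj g).toMonoidHom = conjugate A (x * g⁻¹) := by
  ext y
  simp [conjugate, Subgroup.mem_map, mul_assoc]

lemma card_conjugate (A : Subgroup G) (x : G) : Nat.card (conjugate A x) = Nat.card A :=
  Subgroup.card_map_of_injective (MulAut.conj x⁻¹).injective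

lemma conjugate_map_subtype {R : Subgroup G} [R.Normal] (C : Subgroup R) (x : G) :
    conjugate (C.map R.subtype) x =
      (C.map (MulAut.conjNormal (H := R) x⁻¹).toMonoidHom).map R.subtype := by
  rw [conjugate, Subgroup.map_map, Subgroup.map_map]
  rfl

lemma isSigmaPPermutable_of_encard_eq_one {P : Set ℕ} {σ : Partition P} (hG : primesOf G ⊆ P)
    (h : (σ : Set (Set ℕ)).encard = 1) : IsSigmaPPermutable H σ := by
  intro s hs
  obtain rfl := (eq_of_encard_eq_one h).2 s hs
  refine ⟨⊤, isPiProjector_iff.2 ⟨?_, fun _ _ _ _ _ _ => by simp⟩, fun x => ?_⟩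
  · rw [Subgroup.card_top]
    exact isPiGroup_iff.1 hG
  · have : conjugate (⊤ : Subgroup G) x = ⊤ :=
      Subgroup.map_top_of_surjective _ (MulAut.conj x⁻¹).surjective
    rw [this]
    exact permutes_iff.2 fun h hh x _ => ⟨h * x * h⁻¹, trivial, h, hh, by group⟩

variable [Finite G]

/-- Coprime indices force `H = T ∩ T'`, which `R ∩ Q` normalizes. Once `y` is known to lie in `H(R ∩
Q)`, it lies in a subgroup in which `H` is normal of `π`-index, so the `π'`-element `y` is in `H`.
-/
lemma mem_of_isPiNumber_compl_orderOf {R Q T T' : Subgroup G} [R.Normal] [Q.Normal] (hHT : H ≤ T)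
    (hHT' : H ≤ T') (hT : T ≤ H ⊔ R) (hR : R ≤ Subgroup.normalizer (T : Set G))
    (hQ : Q ≤ Subgroup.normalizer (T' : Set G)) (hi : IsPiNumber π (H.relIndex T))
    (hi' : IsPiNumber πᶜ (H.relIndex T')) (hQi : IsPiNumber π Q.index) {y : G} (hy : y ∈ T)
    (ho : IsPiNumber πᶜ (orderOf y)) : y ∈ H := by
  have hyQ : y ∈ Q := mem_of_isPiNumber_index hQi ho
  have hdvd : ∀ {L M : Subgroup G}, H ≤ L → L ≤ M → H.relIndex L ∣ H.relIndex M :=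
    fun h₁ h₂ => Dvd.intro _ (Subgroup.relIndex_mul_relIndex _ _ _ h₁ h₂)
  have hH : H = T ⊓ T' := by
    refine le_antisymm (le_inf hHT hHT') (Subgroup.relIndex_eq_one.1 (IsPiNumber.eq_one (π := π)
      (hi.of_dvd (hdvd (le_inf hHT hHT') inf_le_left))
      (hi'.of_dvd (hdvd (le_inf hHT hHT') inf_le_right))))
  have hZ : R ⊓ Q ≤ Subgroup.normalizer (H : Set G) := by
    rw [hH]
    exact (inf_le_inf hR hQ).trans Subgroup.inf_normalizer_le_normalizer_inf
  obtain ⟨h, hh, r, hr, hhr⟩ := Subgroup.mem_sup_of_normal_right.1 (hT hy)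
  -- Write `y = hr`. Since `y ∈ Q` and `r ∈ R`, they commute modulo `R ∩ Q`; with `m = |G : Q|` also
  -- `r ^ m ∈ R ∩ Q`, so `y ^ m ≡ h ^ m`. As `m` is prime to the order of `y`, this suffices.
  have hymem : y ∈ H ⊔ R ⊓ Q := by
    refine mem_of_pow_mem_of_coprime (m := Q.index) ?_ (hQi.coprime ho).symm
    have hcomm : Commute (y : G ⧸ (R ⊓ Q)) ((r⁻¹ : G) : G ⧸ (R ⊓ Q)) := by
      refine QuotientGroup.eq.2 ⟨?_, ?_⟩
      · have : (y * r⁻¹)⁻¹ * (r⁻¹ * y) = r * (y⁻¹ * r⁻¹ * y⁻¹⁻¹) := by group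
        rw [this]
        exact mul_mem hr (Subgroup.Normal.conj_mem inferInstance _ (inv_mem hr) _)
      · have : (y * r⁻¹)⁻¹ * (r⁻¹ * y) = (r * y⁻¹ * r⁻¹) * y := by group
        rw [this]
        exact mul_mem (Subgroup.Normal.conj_mem inferInstance _ (inv_mem hyQ) _) hyQ
    have hrm : ((r⁻¹ : G) : G ⧸ (R ⊓ Q)) ^ Q.index = 1 := by
      rw [← QuotientGroup.mk_pow, QuotientGroup.eq_one_iff]
      exact ⟨pow_mem (inv_mem hr) _, Q.pow_index_mem _⟩
    have hq : ((h ^ Q.index : G) : G ⧸ (R ⊓ Q)) = ((y ^ Q.index : G) : G ⧸ (R ⊓ Q)) := by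
      rw [eq_mul_inv_of_mul_eq hhr, QuotientGroup.mk_pow, QuotientGroup.mk_mul, hcomm.mul_pow, hrm,
        mul_one, QuotientGroup.mk_pow]
    have := mul_mem (Subgroup.mem_sup_left (pow_mem hh Q.index) : _ ∈ H ⊔ R ⊓ Q)
      (Subgroup.mem_sup_right (QuotientGroup.eq.1 hq))
    rwa [mul_inv_cancel_left] at this
  set L := T ⊓ (H ⊔ R ⊓ Q) with hL
  have hHL : H ≤ L := le_inf hHT le_sup_left
  have : (H.subgroupOf L).Normal := Subgroup.normal_subgroupOf_of_le_normalizer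
    (inf_le_right.trans (sup_le Subgroup.le_normalizer hZ))
  have hyL : (⟨y, hy, hymem⟩ : L) ∈ H.subgroupOf L :=
    mem_of_isPiNumber_index (π := π) (hi.of_dvd (hdvd hHL inf_le_left))
      (by rwa [← Subgroup.orderOf_coe])
  exact hyL

lemma IsSigmaPPermutable.hasPiCover {P : Set ℕ} {σ : Partition P} (hG : primesOf G ⊆ P)
    (h : IsSigmaPPermutable H σ) {s : Set ℕ} (hs : s ∈ σ) : HasPiCover s H := by
  choose! A hA hperm using h
  -- Used twice: for the block `s` alone, and for all other blocks with `ρ = sᶜ`. The subgroup `R`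
  -- is generated by all conjugates of the chosen projectors.
  have family : ∀ (τ : Set (Set ℕ)) (ρ : Set ℕ), (∀ t ∈ τ, t ∈ σ ∧ t ⊆ ρ) →
      ∃ R T : Subgroup G, R.Normal ∧ (∀ t ∈ τ, A t ≤ R) ∧ H ≤ T ∧ IsPiNumber ρ (H.relIndex T) ∧
        R ≤ Subgroup.normalizer (T : Set G) := by
    intro τ ρ hτ
    let 𝒳 : Set (Subgroup G) := {X | ∃ t ∈ τ, ∃ x, X = conjugate (A t) x}
    have hconj : ∀ X ∈ 𝒳, ∀ g : G, X.map (MulAut.conj g).toMonoidHom ∈ 𝒳 := by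
      rintro _ ⟨t, ht, x, rfl⟩ g
      exact ⟨t, ht, x * g⁻¹, conjugate_map_conj _ _ _⟩
    obtain ⟨T, hHT, hi, hT⟩ := exists_normalized_of_permutes (π := ρ) (𝒳 := 𝒳) (H := H)
      (by
        rintro _ ⟨t, ht, x, rfl⟩
        rw [card_conjugate]
        exact (isPiProjector_iff.1 (hA t (hτ t ht).1)).1.mono (hτ t ht).2)
      hconj (by
        rintro _ ⟨t, ht, x, rfl⟩
        exact hperm t (hτ t ht).1 x)
    exact ⟨sSup 𝒳, T, normal_sSup_of_conj_mem hconj,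
      fun t ht => le_sSup ⟨t, ht, 1, (conjugate_one _).symm⟩, hHT, hi, sSup_le hT⟩
  obtain ⟨R, T, hRn, hAR, hHT, hi, hRT⟩ := family {s} s (by simp [hs])
  obtain ⟨Q, T', hQn, hAQ, hHT', hi', hQT'⟩ := family {t | t ∈ σ ∧ t ≠ s} sᶜ
    fun t ht => ⟨ht.1, fun p hpt hps => ht.2 (σ.eq_of_mem_of_mem ht.1 hs hpt hps)⟩
  have hQi : IsPiNumber s Q.index := by
    intro p hp hd
    by_contra hps
    obtain ⟨t, ht, hpt⟩ := (Partition.mem_iff_exists (P := σ)).1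
      (hG ⟨hp, hd.trans Q.index_dvd_card⟩)
    have hts : t ≠ s := fun h => hps (h ▸ hpt)
    exact (hA t ht).isPiNumber_compl_index (hAQ t ⟨ht, hts⟩) p hp hd hpt
  -- Cutting `T` down to `T ∩ HR` lets its elements factor as `hr`, and `R` still normalizes it.
  refine ⟨R, T ⊓ (H ⊔ R), hRn, (hA s hs).isPiNumber_compl_index (hAR s rfl),
    le_inf hHT le_sup_left, ?_, fun p hp hps y hy hk => ?_⟩
  · exact (le_inf hRT (le_sup_right.trans Subgroup.le_normalizer)).trans
      Subgroup.inf_normalizer_le_normalizer_inf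
  · obtain ⟨k, hk⟩ := hk
    refine mem_of_isPiNumber_compl_orderOf (R := R) (Q := Q) (T := T ⊓ (H ⊔ R)) (T' := T') (π := s)
      (le_inf hHT le_sup_left) hHT' inf_le_right
      ((le_inf hRT (le_sup_right.trans Subgroup.le_normalizer)).trans
        Subgroup.inf_normalizer_le_normalizer_inf) hQT'
      (hi.of_dvd (Dvd.intro _ (Subgroup.relIndex_mul_relIndex _ _ _ (le_inf hHT le_sup_left)
        inf_le_left))) hi' hQi hy ?_
    rw [hk]
    intro q hq hqp
    rw [(Nat.prime_dvd_prime_iff_eq hq hp).1 (hq.dvd_of_dvd_pow hqp)]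
    exact hps

/-- The `p`-elements of `T`, for the primes `p` outside `π`, generate a subgroup of `π`-index that
is normalized by the normalizer of `T`. -/
lemma exists_piResidual (π : Set ℕ) (T : Subgroup G) :
    ∃ U ≤ T, Subgroup.normalizer (T : Set G) ≤ Subgroup.normalizer (U : Set G) ∧
      IsPiNumber π (U.relIndex T) ∧
      ∀ H : Subgroup G, (∀ p : ℕ, p.Prime → p ∉ π → ∀ y ∈ T, (∃ k : ℕ, orderOf y = p ^ k) → y ∈ H) →
        U ≤ H := by
  let S : Set G := {y | y ∈ T ∧ ∃ p : ℕ, p.Prime ∧ p ∉ π ∧ ∃ k : ℕ, orderOf y = p ^ k}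
  refine ⟨Subgroup.closure S, (Subgroup.closure_le T).2 fun y hy => hy.1, ?_, ?_, ?_⟩
  · refine mem_normalizer_of_forall_conj_mem fun a ha => ?_
    rw [Subgroup.map_le_iff_le_comap, Subgroup.closure_le]
    rintro y ⟨hyT, p, hp, hpπ, k, hk⟩
    refine Subgroup.subset_closure ⟨(Subgroup.mem_normalizer_iff.1 ha y).1 hyT, p, hp, hpπ, k, ?_⟩
    rw [← hk]
    exact MulEquiv.orderOf_eq (MulAut.conj a) y
  · intro p hp hd
    by_contra hpπ
    have : Fact p.Prime := ⟨hp⟩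
    let Q : Sylow p T := default
    -- The closure contains a Sylow `p`-subgroup of `T`, so `p` cannot divide its index.
    have hle : (Q : Subgroup T) ≤ (Subgroup.closure S).subgroupOf T := by
      intro y hy
      obtain ⟨k, hk⟩ := IsPGroup.iff_orderOf.1 Q.isPGroup' ⟨y, hy⟩
      refine Subgroup.subset_closure ⟨y.2, p, hp, hpπ, k, ?_⟩
      exact (Subgroup.orderOf_coe y).trans ((Subgroup.orderOf_coe (⟨y, hy⟩ : (Q : Subgroup T))).trans hk)
    exact Q.not_dvd_index (hd.trans (Subgroup.index_dvd_of_le hle))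
  · intro H hH
    rw [Subgroup.closure_le]
    rintro y ⟨hyT, p, hp, hpπ, hk⟩
    exact hH p hp hpπ y hyT hk

/-- Let `U` be generated by the `p`-elements of `T` with `p ∉ π`. Then `U ≤ H`, and `C ≤ R`
normalizes `U`, so it is enough that `H ≤ CU`. This follows from `H = U(H ∩ R)` and `T ∩ R ≤ CU`. -/
lemma permutes_of_isPiProjector {R T : Subgroup G} [R.Normal] (hRi : IsPiNumber πᶜ R.index)
    (hHT : H ≤ T) (hRT : R ≤ Subgroup.normalizer (T : Set G))
    (hT : ∀ p : ℕ, p.Prime → p ∉ π → ∀ y ∈ T, (∃ k : ℕ, orderOf y = p ^ k) → y ∈ H)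
    {C : Subgroup R} (hC : IsPiProjector π C) : Permutes H (C.map R.subtype) := by
  obtain ⟨U, hUT, hTU, hUi, hU⟩ := exists_piResidual π T
  replace hU := hU H hT
  have hTU' : T ≤ Subgroup.normalizer (U : Set G) := Subgroup.le_normalizer.trans hTU
  have hRU : R ≤ Subgroup.normalizer (U : Set G) := hRT.trans hTU
  have hCR : C.map R.subtype ≤ R := Subgroup.map_subtype_le C
  have hCcard : IsPiNumber π (Nat.card (C.map R.subtype)) := by
    rw [Subgroup.card_subtype]
    exact (isPiProjector_iff.1 hC).1
  have hTRn : C.map R.subtype ≤ Subgroup.normalizer ((T ⊓ R : Subgroup G) : Set G) :=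
    hCR.trans ((le_inf hRT Subgroup.le_normalizer).trans Subgroup.inf_normalizer_le_normalizer_inf)
  set D := C.map R.subtype ⊔ T ⊓ R with hD
  have hDR : D ≤ R := sup_le hCR inf_le_right
  have hDi : IsPiNumber π ((U ⊓ R).relIndex D) := by
    rw [← Subgroup.relIndex_mul_relIndex (U ⊓ R) (T ⊓ R) D (inf_le_inf_right R hUT) le_sup_right]
    refine IsPiNumber.mul ?_ ?_
    · rw [← Subgroup.inf_relIndex_right, inf_assoc, inf_eq_right.2 (inf_le_right : T ⊓ R ≤ R),
        Subgroup.inf_relIndex_right]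
      exact hUi.of_dvd (relIndex_dvd_relIndex_of_le_normalizer hTU' inf_le_left)
    · rw [relIndex_eq_of_subset_mul (X := C.map R.subtype) le_sup_left]
      · exact hCcard.of_dvd (Subgroup.relIndex_dvd_card _ _)
      · intro k hk
        rw [← SetLike.mem_coe, Subgroup.coe_mul_of_left_le_normalizer_right _ _ hTRn] at hk
        obtain ⟨x, hx, t, ht, he⟩ := Set.mem_mul.1 hk
        exact ⟨x, hx, t, ht, he.symm⟩
  -- The projector property of `C` in `R` modulo `U ∩ R`: the overgroup `D = C(T ∩ R)` has `π`-index
  -- over `U ∩ R`.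
  have hTR : T ⊓ R ≤ C.map R.subtype ⊔ U := by
    have := hC.inf_le (K := U ⊓ R) (D := D)
      ((le_inf hRU Subgroup.le_normalizer).trans Subgroup.inf_normalizer_le_normalizer_inf)
      le_sup_left (inf_le_left.trans ((inf_le_inf_right R hUT).trans le_sup_right))
      (by rwa [inf_eq_left.2 hDR])
    rw [inf_eq_left.2 hDR] at this
    exact le_sup_right.trans (this.trans (sup_le_sup_left inf_le_left _))
  have hH : (U ⊔ H ⊓ R).relIndex H = 1 := by
    refine IsPiNumber.eq_one (π := π)
      (hUi.of_dvd ((Subgroup.relIndex_dvd_of_le_left H le_sup_left).trans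
        (relIndex_dvd_relIndex_of_le_normalizer hTU' hHT)))
      (hRi.of_dvd ((Subgroup.relIndex_dvd_of_le_left H le_sup_right).trans ?_))
    rw [Subgroup.inf_relIndex_left]
    exact Subgroup.relIndex_dvd_index_of_normal R H
  exact permutes_of_le_sup hU ((Subgroup.relIndex_eq_one.1 hH).trans
    (sup_le le_sup_right ((inf_le_inf_right R hHT).trans hTR))) (hCR.trans hRU)

lemma HasPiCover.exists_isPiProjector (h : HasPiCover π H) :
    ∃ A : Subgroup G, IsPiProjector π A ∧ ∀ x : G, Permutes H (conjugate A x) := by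
  obtain ⟨R, T, hR, hRi, hHT, hRT, hT⟩ := h
  obtain ⟨C, hC⟩ := SigmaTheory.exists_isPiProjector π R
  refine ⟨C.map R.subtype, hC.of_normal hRi, fun x => ?_⟩
  rw [conjugate_map_subtype]
  exact permutes_of_isPiProjector hRi hHT hRT hT (hC.map_mulEquiv _)

lemma isSigmaPPermutable_inf {P : Set ℕ} {σ₁ σ₂ : Partition P} (hG : primesOf G ⊆ P)
    (h₁ : IsSigmaPPermutable H σ₁) (h₂ : IsSigmaPPermutable H σ₂) :
    IsSigmaPPermutable H (σ₁ ⊓ σ₂) := by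
  intro s hs
  obtain ⟨-, s₁, hs₁, s₂, hs₂, rfl⟩ := Partition.mem_inf_iff.1 hs
  exact ((h₁.hasPiCover hG hs₁).inter (h₂.hasPiCover hG hs₂)).exists_isPiProjector

end PiCover

end SigmaTheory

/-- `σ`-nilpotency and `σ`-solubility (of the group `G`, and of a subgroup `H` of `G`),
`σ`-subnormality and `σ`-`p`-permutability (of `H` in `G`) are `σ`-properties. -/
theorem theorem1 :
    SigmaTheory.IsSigmaProperty.{u} (fun G _ _ _ σ => SigmaTheory.IsSigmaNilpotent G σ) ∧
    SigmaTheory.IsSigmaProperty.{u} (fun _ _ H _ σ => SigmaTheory.IsSigmaNilpotent H σ) ∧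
    SigmaTheory.IsSigmaProperty.{u} (fun G _ _ _ σ => SigmaTheory.IsSigmaSoluble G σ) ∧
    SigmaTheory.IsSigmaProperty.{u} (fun _ _ H _ σ => SigmaTheory.IsSigmaSoluble H σ) ∧
    SigmaTheory.IsSigmaProperty.{u} (fun _ _ H _ σ => SigmaTheory.IsSigmaSubnormal H σ) ∧
    SigmaTheory.IsSigmaProperty.{u} (fun _ _ H _ σ => SigmaTheory.IsSigmaPPermutable H σ) := by
  open SigmaTheory in
  exact ⟨fun G _ _ H P _ hG => ⟨fun _ _ => isSigmaNilpotent_inf,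
      fun _ => isSigmaNilpotent_of_encard_eq_one hG⟩,
    fun G _ _ H P _ hG => ⟨fun _ _ => isSigmaNilpotent_inf,
      fun _ => isSigmaNilpotent_of_encard_eq_one ((primesOf_subgroup_subset H).trans hG)⟩,
    fun G _ _ H P _ hG => ⟨fun _ _ => isSigmaSoluble_inf,
      fun _ => isSigmaSoluble_of_encard_eq_one hG⟩,
    fun G _ _ H P _ hG => ⟨fun _ _ => isSigmaSoluble_inf,
      fun _ => isSigmaSoluble_of_encard_eq_one ((primesOf_subgroup_subset H).trans hG)⟩,
    fun G _ _ H P _ hG => ⟨fun _ _ => isSigmaSubnormal_inf,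
      fun _ => isSigmaSubnormal_of_encard_eq_one hG⟩,
    fun G _ _ H P _ hG => ⟨fun _ _ => isSigmaPPermutable_inf hG,
      fun _ => isSigmaPPermutable_of_encard_eq_one hG⟩⟩
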